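/- Let $m\ge 3$ be a prime, $n=2^m-1$ and $h=\frac{2^{m-1}-1}{m}$ (an integer). For $a\in\{0,\dots,n-1\}$ the $2$-cyclotomic coset of $a$ modulo $n$ is $\{a2^i \bmod n : i\ge 0\}\subseteq\{0,\dots,n-1\}$, and its smallest element is called a coset leader. Let $\delta_h$ be the $h$-th nonzero $2$-cyclotomic coset leader modulo $n$ in increasing order (the $h$-th smallest one). Let $\beta$ be a primitive $n$-th root of unity in an extension field of $\mathbf F_2$ (for instance a primitive element of $\mathbf F_{2^m}$), and let $\mathrm m_{\beta^i}(x)=\prod_{j}(x-\beta^j)\in\mathbf F_2[x]$, with $j$ running over the $2$-cyclotomic coset of $i$ modulo $n$, be the minimal polynomial of $\beta^i$ over $\mathbf F_2$. For integers $\delta\ge 2$ and $b$, let $\mathbf C_{(2,n,\delta,b)}$ be the binary cyclic code of length $n$ generated by $\mathrm{lcm}\{\mathrm m_{\beta^b}(x),\dots,\mathrm m_{\beta^{b+\delta-2}}(x)\}$. For binary cyclic codes $\mathbf C_2\subseteq\mathbf C_1$ of length $n$ with generator polynomials $g_1g_2$ and $g_1$ respectively, let $\mathbf C(\mathbf C_1,\mathbf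 C_2)$ be the binary cyclic code of length $2n$ generated by $g_1(x)^2g_2(x)$. Then $\mathbf C=\mathbf C\bigl(\mathbf C_{(2,n,\delta_h+2,1)},\,\mathbf C_{(2,n,\delta_h+2,0)}\bigr)$ is a repeated-root binary cyclic code (its generator polynomial has a repeated root in an extension field of $\mathbf F_2$) of length $2n$ and dimension $n$, and its minimum Hamming distance $d$ satisfies $$d\ \ge\ \delta_h+3\ \ge\ \frac{n-1+2m}{m}.$$ -/

import Mathlib

open Polynomial

noncomputable section

namespace CyclicCodes

/-- The polynomial `c₀ + c₁ x + ⋯ + c_{n-1} x^{n-1}` of a word `c`. -/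
def wordPoly {F : Type*} [Field F] (n : ℕ) : (Fin n → F) →ₗ[F] F[X] :=
  ∑ i : Fin n, (Polynomial.monomial (i : ℕ)) ∘ₗ (LinearMap.proj i)

/-- A linear code of length `n` is cyclic if with `(c₀, …, c_{n-1})` it contains
`(c_{n-1}, c₀, …, c_{n-2})`. -/
def IsCyclicCode {F : Type*} [Field F] {n : ℕ} (C : Submodule F (Fin n → F)) : Prop :=
  ∀ c ∈ C, (fun i => c ((finRotate n).symm i)) ∈ C

/-- The minimum Hamming distance of a code (`0` if the code has at most one word). -/
def minDist {F : Type*} [Field F] [DecidableEq F] {n : ℕ} (C : Submodule F (Fin n → F)) : ℕ :=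
  sInf {d | ∃ a ∈ C, ∃ b ∈ C, a ≠ b ∧ hammingDist a b = d}

/-- The cyclic code of length `n` generated by `g`: the words `c` such that the class of `c(x)`
lies in the ideal of `F[x]/(x^n - 1)` generated by the class of `g`, i.e. `c(x) ∈ (g, x^n - 1)`. -/
def cyclicCode {F : Type*} [Field F] (n : ℕ) (g : F[X]) : Submodule F (Fin n → F) :=
  Submodule.comap (wordPoly n) ((Ideal.span {g, X ^ n - 1} : Ideal F[X]).restrictScalars F)

open Classical in
/-- The generator polynomial of a cyclic code `C` of length `n`: the monic generator of the ideal
of `F[x]` generated by the polynomials of the words of `C` and by `x^n - 1`. -/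
def generatorPoly {F : Type*} [Field F] {n : ℕ} (C : Submodule F (Fin n → F)) : F[X] :=
  normalize (Submodule.IsPrincipal.generator
    (Ideal.span (insert (X ^ n - 1) ((wordPoly n) '' (C : Set (Fin n → F)))) : Ideal F[X]))

/-- If `g` is monic and divides `x^n - 1`, then `g` is the generator polynomial of the cyclic code
of length `n` generated by `g`. -/
theorem generatorPoly_cyclicCode {F : Type*} [Field F] {n : ℕ} (hn : n ≠ 0) {g : F[X]}
    (hg : g.Monic) (hdvd : g ∣ X ^ n - 1) : generatorPoly (cyclicCode n g) = g := by
  classical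
  have hI : (Ideal.span (insert (X ^ n - 1 : F[X])
      ((wordPoly n) '' (cyclicCode n g : Set (Fin n → F)))) : Ideal F[X]) = Ideal.span {g} := by
    have hpair : (Ideal.span {g, X ^ n - 1} : Ideal F[X]) = Ideal.span {g} := by
      apply le_antisymm
      · rw [Ideal.span_le]
        rintro p (rfl | rfl)
        · exact Ideal.subset_span rfl
        · exact Ideal.mem_span_singleton.2 hdvd
      · exact Ideal.span_mono (by simp)
    apply le_antisymm
    · rw [Ideal.span_le]
      rintro p (rfl | ⟨c, hc, rfl⟩)
      · exact Ideal.mem_span_singleton.2 hdvd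
      · have hc' : wordPoly n c ∈ (Ideal.span {g, X ^ n - 1} : Ideal F[X]) := hc
        rwa [hpair] at hc'
    · rw [Ideal.span_singleton_le_iff_mem]
      have hmon : (X ^ n - 1 : F[X]).Monic := by
        simpa using monic_X_pow_sub_C (1 : F) hn
      have hdeg : g.natDegree ≤ n := by
        have h1 := natDegree_le_of_dvd hdvd hmon.ne_zero
        have h2 : (X ^ n - 1 : F[X]).natDegree = n := by
          simpa using natDegree_X_pow_sub_C (n := n) (r := (1 : F))
        omega
      rcases hdeg.lt_or_eq with hlt | heq
      · have hw : wordPoly n (fun i : Fin n => g.coeff i) = g := by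
          conv_rhs => rw [as_sum_range' g n hlt,
            ← Fin.sum_univ_eq_sum_range (fun i => monomial i (g.coeff i)) n]
          simp [wordPoly]
        apply Ideal.subset_span
        right
        refine ⟨fun i => g.coeff i, ?_, hw⟩
        change wordPoly n (fun i : Fin n => g.coeff i) ∈ (Ideal.span {g, X ^ n - 1} : Ideal F[X])
        rw [hw, hpair]
        exact Ideal.subset_span rfl
      · have : g = X ^ n - 1 := by
          refine (eq_of_monic_of_dvd_of_natDegree_le hg hmon hdvd ?_).symm
          rw [heq]
          simpa using (natDegree_X_pow_sub_C (n := n) (r := (1 : F))).le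
        rw [this]
        exact Ideal.subset_span (Or.inl rfl)
  have hass : Associated (Submodule.IsPrincipal.generator
      (Ideal.span (insert (X ^ n - 1 : F[X])
      ((wordPoly n) '' (cyclicCode n g : Set (Fin n → F)))) : Ideal F[X])) g := by
    rw [← Ideal.span_singleton_eq_span_singleton, Ideal.span_singleton_generator]
    exact hI
  rw [generatorPoly, normalize_eq_normalize_iff_associated.2 hass]
  exact hg.normalize_eq_self

/-- A cyclic code is repeated-root if its generator polynomial has a repeated root in an
extension field. -/
def IsRepeatedRootCyclicCode {F : Type*} [Field F] {n : ℕ} (C : Submodule F (Fin n → F)) : Prop :=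
  IsCyclicCode C ∧ ∃ a : AlgebraicClosure F,
    2 ≤ ((generatorPoly C).map (algebraMap F (AlgebraicClosure F))).rootMultiplicity a

/-- The cyclic code `C(C₁, C₂)` of length `2n`, generated by `g₁² g₂`, where `g₁` and `g₁ g₂` are
the generator polynomials of the cyclic codes `C₁` and `C₂ ⊆ C₁` of length `n`. -/
def doubledCode {F : Type*} [Field F] {n : ℕ} (C₁ C₂ : Submodule F (Fin n → F)) :
    Submodule F (Fin (2 * n) → F) :=
  cyclicCode (2 * n) (generatorPoly C₁ ^ 2 * (generatorPoly C₂ / generatorPoly C₁))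

/-- The `q`-cyclotomic coset `{a q^i mod n : i ≥ 0}` of `a` modulo `n`. -/
def cyclotomicCoset (q n a : ℕ) : Set ℕ := {u | ∃ i : ℕ, u = a * q ^ i % n}

/-- `a` is the smallest element of a `q`-cyclotomic coset modulo `n`. -/
def IsCosetLeader (q n a : ℕ) : Prop := ∃ b < n, IsLeast (cyclotomicCoset q n b) a

/-- The `h`-th nonzero `q`-cyclotomic coset leader modulo `n` in increasing order (`h ≥ 1`). -/
def nonzeroCosetLeader (q n h : ℕ) : ℕ := Nat.nth (fun a => a ≠ 0 ∧ IsCosetLeader q n a) (h - 1)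

/-- Over a field with `q` elements the minimal polynomial of `β^a` is
the product of `x - β^j` over the `q`-cyclotomic coset of `a` modulo `n`. -/
theorem map_minpoly_eq_prod {F : Type*} [Field F] [Fintype F] {K : Type*} [Field K] [Algebra F K]
    {β : K} {n : ℕ} (hn : n ≠ 0) (hβ : IsPrimitiveRoot β n) (a : ℕ) :
    (minpoly F (β ^ a)).map (algebraMap F K) =
      ∏ᶠ j ∈ cyclotomicCoset (Fintype.card F) n a, (X - C (β ^ j)) := by
  classical
  set q := Fintype.card F with hq
  have hmod : ∀ k : ℕ, β ^ (k % n) = β ^ k := fun k => by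
    conv_rhs => rw [← Nat.mod_add_div k n, pow_add, pow_mul, hβ.pow_eq_one, one_pow, mul_one]
  have hlt : ∀ j ∈ cyclotomicCoset q n a, j < n := by
    rintro j ⟨i, rfl⟩
    exact Nat.mod_lt _ (Nat.pos_of_ne_zero hn)
  have hfin : (cyclotomicCoset q n a).Finite :=
    (Set.finite_lt_nat n).subset hlt
  rw [finprod_mem_eq_finite_toFinset_prod _ hfin]
  set S := hfin.toFinset with hS
  have hinj : Set.InjOn (fun j : ℕ => β ^ j) S := by
    intro i hi j hj hij
    exact hβ.pow_inj (hlt i (by simpa [hS] using hi)) (hlt j (by simpa [hS] using hj)) hij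
  have hP : (∏ j ∈ S, (X - C (β ^ j))) = ∏ y ∈ S.image (fun j => β ^ j), (X - C y) := by
    rw [Finset.prod_image hinj]
  rw [hP]
  set T := S.image (fun j => β ^ j) with hT
  have hTmem : ∀ y, y ∈ T ↔ ∃ i : ℕ, y = (β ^ a) ^ q ^ i := by
    intro y
    simp only [hT, hS, Finset.mem_image, Set.Finite.mem_toFinset, cyclotomicCoset,
      Set.mem_ofPred_eq]
    constructor
    · rintro ⟨j, ⟨i, rfl⟩, rfl⟩
      exact ⟨i, by rw [hmod, pow_mul]⟩
    · rintro ⟨i, rfl⟩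
      exact ⟨_, ⟨i, rfl⟩, by rw [hmod, pow_mul]⟩
  set φ : K →ₐ[F] K := FiniteField.frobeniusAlgHom F K with hφ
  have hφi : Function.Injective φ := φ.toRingHom.injective
  have hφa : ∀ x, φ x = x ^ q := fun x => rfl
  have hφT : T.image φ = T := by
    apply Finset.eq_of_subset_of_card_le
    · intro y hy
      obtain ⟨x, hx, rfl⟩ := Finset.mem_image.1 hy
      obtain ⟨i, rfl⟩ := (hTmem x).1 hx
      exact (hTmem _).2 ⟨i + 1, by rw [hφa, ← pow_mul, pow_succ]⟩
    · rw [Finset.card_image_of_injective _ hφi]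
  have hPφ : (∏ y ∈ T, (X - C y)).map (φ : K →+* K) = ∏ y ∈ T, (X - C y) := by
    rw [Polynomial.map_prod]
    simp only [Polynomial.map_sub, map_X, map_C]
    conv_rhs => rw [← hφT, Finset.prod_image (fun x _ y _ h => hφi h)]
    rfl
  have hfix : ∀ c : K, c ^ q = c → c ∈ Set.range (algebraMap F K) := by
    intro c hc
    have hne : (X ^ q - X : K[X]) ≠ 0 :=
      FiniteField.X_pow_card_sub_X_ne_zero K Fintype.one_lt_card
    have hsub : Finset.univ.image (algebraMap F K) = (X ^ q - X : K[X]).roots.toFinset := by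
      apply Finset.eq_of_subset_of_card_le
      · intro y hy
        obtain ⟨x, -, rfl⟩ := Finset.mem_image.1 hy
        rw [Multiset.mem_toFinset, mem_roots hne]
        simp [IsRoot, ← map_pow, hq, FiniteField.pow_card]
      · rw [Finset.card_image_of_injective _ (algebraMap F K).injective, Finset.card_univ]
        calc _ ≤ _ := Multiset.toFinset_card_le _
          _ ≤ _ := card_roots' _
          _ = q := FiniteField.X_pow_card_sub_X_natDegree_eq K Fintype.one_lt_card
    have : c ∈ Finset.univ.image (algebraMap F K) := by
      rw [hsub, Multiset.mem_toFinset, mem_roots hne]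
      simp [IsRoot, hc]
    obtain ⟨x, -, hx⟩ := Finset.mem_image.1 this
    exact ⟨x, hx⟩
  obtain ⟨p, hp⟩ : ∃ p : F[X], p.map (algebraMap F K) = ∏ y ∈ T, (X - C y) := by
    rw [← Polynomial.mem_lifts, Polynomial.lifts_iff_coeff_lifts]
    intro k
    apply hfix
    conv_rhs => rw [← hPφ]
    rw [coeff_map]
    rfl
  have hmonP : (∏ y ∈ T, (X - C y)).Monic := monic_prod_of_monic _ _ fun y _ => monic_X_sub_C y
  have hint : IsIntegral F (β ^ a) := by
    refine IsIntegral.pow ⟨X ^ n - 1, ?_, ?_⟩ a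
    · simpa using monic_X_pow_sub_C (1 : F) hn
    · simp [hβ.pow_eq_one]
  have hdvd1 : (minpoly F (β ^ a)).map (algebraMap F K) ∣ ∏ y ∈ T, (X - C y) := by
    rw [← hp]
    apply Polynomial.map_dvd
    apply minpoly.dvd
    rw [aeval_def, ← eval_map, hp, eval_prod]
    exact Finset.prod_eq_zero (i := β ^ a) ((hTmem _).2 ⟨0, by simp⟩) (by simp)
  have hroot : ∀ i : ℕ, aeval ((β ^ a) ^ q ^ i) (minpoly F (β ^ a)) = 0 := by
    intro i
    induction i with
    | zero => simp
    | succ i ih =>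
      rw [pow_succ, pow_mul, ← hφa, aeval_algHom_apply, ih, map_zero]
  have hdvd2 : ∏ y ∈ T, (X - C y) ∣ (minpoly F (β ^ a)).map (algebraMap F K) := by
    apply Finset.prod_dvd_of_coprime
    · intro x _ y _ hxy
      exact isCoprime_X_sub_C_of_isUnit_sub (sub_ne_zero.2 hxy).isUnit
    · intro y hy
      obtain ⟨i, rfl⟩ := (hTmem y).1 hy
      rw [dvd_iff_isRoot, IsRoot, eval_map, ← aeval_def]
      exact hroot i
  exact eq_of_monic_of_associated ((minpoly.monic hint).map _) hmonP
    (associated_of_dvd_dvd hdvd1 hdvd2)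

open Classical in
/-- The polynomial `lcm(m_{β^b}, …, m_{β^{b+δ-2}})` over `F`, where `m_{β^i}` is the minimal
polynomial of `β^i` over `F` (`map_minpoly_eq_prod` above writes it as a product over a
cyclotomic coset). The least common multiple is the monic one. -/
def bchPoly (F : Type*) [Field F] {K : Type*} [Field K] [Algebra F K] (β : K) (δ : ℕ) (b : ℤ) :
    F[X] :=
  letI : NormalizedGCDMonoid F[X] := UniqueFactorizationMonoid.toNormalizedGCDMonoid F[X]
  (Finset.range (δ - 1)).lcm fun i => minpoly F (β ^ (b + (i : ℤ)))

/-- The BCH code of length `n` and designed distance `δ` over `F`, with respect to the primitive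
`n`-th root of unity `β`. -/
def bchCode (F : Type*) [Field F] {K : Type*} [Field K] [Algebra F K] (β : K) (n δ : ℕ) (b : ℤ) :
    Submodule F (Fin n → F) :=
  cyclicCode n (bchPoly F β δ b)

end CyclicCodes

end

/-! Let `g` be the product of the minimal polynomials of `β^a` over the first `h` nonzero coset
leaders `a`. Nonzero leaders are odd, so `δ` is odd and the leader of the even number `δ + 1` is at
most `δ`. Hence `g` vanishes at `β, …, β^(δ+1)`, one power more than its definition suggests
(`exists_mem_leadersUpTo`). The two BCH codes are therefore generated by `g` and `g (x - 1)`, and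
the doubled code by `g² (x - 1)`.

Dimension: as `m` is prime, every nonzero coset has exactly `m` elements, so `deg g = h m = (n - 1)
/ 2` and `deg g² (x - 1) = n`.

Distance: over `𝔽₂` write `c = a² + x b²` by splitting exponents by parity; then `wt c = wt a + wt
b`. For `c` divisible by `g² (x - 1)`, both `a` and `b` are multiples of `g` and `a + b` is a
multiple of `g (x - 1)`. If `a = b`, the weight is at least `2 (δ + 2)` by the BCH bound for `g`.
Otherwise it is at least `wt (a + b) ≥ δ + 3`, by the BCH bound for the `δ + 2` consecutive zeros
`1, β, …, β^(δ+1)` (`le_card_support_of_sq_mul_dvd`).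

Size of `δ`: it is at least the `h`-th odd number, `2h - 1`, so `δ + 3 ≥ 2h + 2 = (n - 1) / m + 2`.
-/

namespace CyclicCodes

/-! ### Binary cyclotomic cosets modulo `2^m - 1`. -/

section Cosets

variable {m : ℕ}

theorem two_pow_modEq_one (m : ℕ) : 2 ^ m ≡ 1 [MOD 2 ^ m - 1] :=
  ((Nat.modEq_iff_dvd' Nat.one_le_two_pow).2 dvd_rfl).symm

theorem odd_two_pow_sub_one (hm : m ≠ 0) : Odd (2 ^ m - 1) :=
  Nat.Even.sub_odd Nat.one_le_two_pow ((Nat.even_pow' hm).2 even_two) odd_one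

theorem mod_mem_cyclotomicCoset (q n a : ℕ) : a % n ∈ cyclotomicCoset q n a := ⟨0, by simp⟩

theorem lt_of_mem_cyclotomicCoset {q n a u : ℕ} (hn : 0 < n) (h : u ∈ cyclotomicCoset q n a) :
    u < n := by
  obtain ⟨i, rfl⟩ := h
  exact Nat.mod_lt _ hn

/-- Since `2^m ≡ 1`, multiplication by `2^i` is undone by `2^(i (m - 1))`, so cosets are orbits and
partition the residues. -/
theorem cyclotomicCoset_eq_of_mem (hm : m ≠ 0) {a b : ℕ}
    (h : a ∈ cyclotomicCoset 2 (2 ^ m - 1) b) :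
    cyclotomicCoset 2 (2 ^ m - 1) a = cyclotomicCoset 2 (2 ^ m - 1) b := by
  obtain ⟨i, rfl⟩ := h
  ext u
  constructor
  · rintro ⟨j, rfl⟩
    exact ⟨i + j, by rw [Nat.mod_mul_mod, pow_add, mul_assoc]⟩
  · rintro ⟨j, rfl⟩
    refine ⟨j + i * (m - 1), ?_⟩
    rw [Nat.mod_mul_mod]
    have h1 : b * 2 ^ i * 2 ^ (j + i * (m - 1)) = b * 2 ^ j * (2 ^ m) ^ i := by
      obtain ⟨k, rfl⟩ : ∃ k, m = k + 1 := ⟨m - 1, by omega⟩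
      simp only [Nat.add_sub_cancel]
      ring
    rw [h1]
    have h2 := ((two_pow_modEq_one m).pow i).mul_left (b * 2 ^ j)
    rw [one_pow, mul_one] at h2
    exact h2.symm

theorem cyclotomicCoset_eq_image_range (hm : m ≠ 0) (a : ℕ) :
    cyclotomicCoset 2 (2 ^ m - 1) a =
      ((Finset.range m).image fun i => a * 2 ^ i % (2 ^ m - 1) : Finset ℕ) := by
  ext u
  simp only [cyclotomicCoset, Set.mem_ofPred_eq, Finset.coe_image, Set.mem_image, Finset.coe_range,
    Set.mem_Iio]
  constructor
  · rintro ⟨i, rfl⟩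
    refine ⟨i % m, Nat.mod_lt _ (Nat.pos_of_ne_zero hm), ?_⟩
    conv_rhs => rw [← Nat.mod_add_div i m, pow_add, pow_mul, ← mul_assoc]
    have h := ((two_pow_modEq_one m).pow (i / m)).mul_left (a * 2 ^ (i % m))
    rw [one_pow, mul_one] at h
    exact h.symm
  · rintro ⟨i, -, rfl⟩
    exact ⟨i, rfl⟩

theorem coprime_two_pow (hm : m ≠ 0) (i : ℕ) : Nat.Coprime (2 ^ m - 1) (2 ^ i) :=
  (Nat.coprime_two_right.2 (odd_two_pow_sub_one hm)).pow_right i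

/-- This is why nonzero cosets have full size `m`: a coincidence would make `n` divide `a (2^(j-i) -
1) 2^i`, while `gcd(2^m - 1, 2^d - 1) = 2^(gcd(m, d)) - 1 = 1` for `0 < d < m` with `m` prime. -/
theorem injOn_mul_two_pow_mod (hm : m.Prime) {a : ℕ} (ha : ¬ 2 ^ m - 1 ∣ a) :
    Set.InjOn (fun i => a * 2 ^ i % (2 ^ m - 1)) (Finset.range m) := by
  have key : ∀ i j, i < j → j < m → a * 2 ^ i % (2 ^ m - 1) ≠ a * 2 ^ j % (2 ^ m - 1) := by
    intro i j hij hjm h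
    have h1 : 2 ^ m - 1 ∣ a * 2 ^ j - a * 2 ^ i :=
      (Nat.modEq_iff_dvd' (Nat.mul_le_mul_left _ (Nat.pow_le_pow_right two_pos hij.le))).1 h
    have h2 : a * 2 ^ j - a * 2 ^ i = a * (2 ^ (j - i) - 1) * 2 ^ i := by
      obtain ⟨k, rfl⟩ := Nat.exists_eq_add_of_lt hij
      have : i + k + 1 - i = k + 1 := by omega
      rw [this, Nat.mul_sub, Nat.sub_mul]
      congr 1 <;> ring
    rw [h2] at h1
    have h3 := (coprime_two_pow hm.ne_zero i).dvd_of_dvd_mul_right h1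
    have h4 : Nat.Coprime (2 ^ m - 1) (2 ^ (j - i) - 1) := by
      rw [Nat.Coprime, Nat.pow_sub_one_gcd_pow_sub_one,
        Nat.Coprime.gcd_eq_one (Nat.coprime_of_lt_prime (by omega) (by omega) hm)]
      rfl
    exact ha (h4.dvd_of_dvd_mul_right h3)
  intro i hi j hj h
  rcases lt_trichotomy i j with hij | hij | hij
  · exact absurd h (key i j hij (by simpa using hj))
  · exact hij
  · exact absurd h.symm (key j i hij (by simpa using hi))

theorem IsCosetLeader.isLeast (hm : m ≠ 0) {a : ℕ} (h : IsCosetLeader 2 (2 ^ m - 1) a) :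
    IsLeast (cyclotomicCoset 2 (2 ^ m - 1) a) a := by
  obtain ⟨b, -, hb⟩ := h
  rwa [cyclotomicCoset_eq_of_mem hm hb.1]

theorem IsCosetLeader.lt {q n a : ℕ} (h : IsCosetLeader q n a) : a < n := by
  obtain ⟨b, hbn, hb⟩ := h
  exact lt_of_mem_cyclotomicCoset (by omega) hb.1

theorem exists_isCosetLeader_mem (q : ℕ) {n i : ℕ} (hi : i < n) :
    ∃ l ∈ cyclotomicCoset q n i, IsCosetLeader q n l ∧ l ≤ i := by
  have hmem : i ∈ cyclotomicCoset q n i := by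
    simpa [Nat.mod_eq_of_lt hi] using mod_mem_cyclotomicCoset q n i
  have hl := isLeast_csInf ⟨i, hmem⟩
  exact ⟨_, hl.1, ⟨i, hi, hl⟩, hl.2 hmem⟩

theorem ne_zero_of_mem_cyclotomicCoset (hm : m ≠ 0) {i l : ℕ} (hi0 : i ≠ 0) (hi : i < 2 ^ m - 1)
    (hl : l ∈ cyclotomicCoset 2 (2 ^ m - 1) i) : l ≠ 0 := by
  rintro rfl
  obtain ⟨k, hk⟩ := hl
  have h := (coprime_two_pow hm k).dvd_of_dvd_mul_right (Nat.dvd_of_mod_eq_zero hk.symm)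
  exact absurd (Nat.le_of_dvd (Nat.pos_of_ne_zero hi0) h) (by omega)

/-- An even nonzero element is never least, because its half lies in the same coset. -/
theorem IsCosetLeader.odd (hm : m ≠ 0) {a : ℕ} (ha : a ≠ 0)
    (h : IsCosetLeader 2 (2 ^ m - 1) a) : Odd a := by
  rw [← Nat.not_even_iff_odd]
  rintro ⟨c, rfl⟩
  have hlt := h.lt
  have hc : c ∈ cyclotomicCoset 2 (2 ^ m - 1) (c + c) := by
    -- Multiplying by `2^(m-1)` is halving, since `2^m ≡ 1`.
    refine ⟨m - 1, ?_⟩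
    have h1 : (c + c) * 2 ^ (m - 1) = c * 2 ^ m := by
      obtain ⟨k, rfl⟩ : ∃ k, m = k + 1 := ⟨m - 1, by omega⟩
      simp only [Nat.add_sub_cancel]
      ring
    have h2 : c * 2 ^ m % (2 ^ m - 1) = c * 1 % (2 ^ m - 1) := (two_pow_modEq_one m).mul_left c
    rw [h1, h2, mul_one, Nat.mod_eq_of_lt (by omega)]
  have := (h.isLeast hm).2 hc
  omega

/-- The cosets of the nonzero leaders cover `1, …, n - 1`, and each has at most `m` elements. -/
theorem le_card_nonzero_cosetLeaders_mul (hm : m ≠ 0)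
    (hf : (Set.ofPred fun a => a ≠ 0 ∧ IsCosetLeader 2 (2 ^ m - 1) a).Finite) :
    2 ^ m - 1 - 1 ≤ hf.toFinset.card * m := by
  have hsub : Finset.Ico 1 (2 ^ m - 1) ⊆ hf.toFinset.biUnion fun l =>
      (Finset.range m).image fun i => l * 2 ^ i % (2 ^ m - 1) := by
    intro i hi
    rw [Finset.mem_Ico] at hi
    obtain ⟨l, hl, hlead, -⟩ := exists_isCosetLeader_mem 2 hi.2
    rw [Finset.mem_biUnion]
    refine ⟨l, ?_, ?_⟩
    · rw [Set.Finite.mem_toFinset]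
      exact ⟨ne_zero_of_mem_cyclotomicCoset hm (by omega) hi.2 hl, hlead⟩
    · rw [← Finset.mem_coe, ← cyclotomicCoset_eq_image_range hm, cyclotomicCoset_eq_of_mem hm hl]
      simpa [Nat.mod_eq_of_lt hi.2] using mod_mem_cyclotomicCoset 2 (2 ^ m - 1) i
  calc 2 ^ m - 1 - 1 = (Finset.Ico 1 (2 ^ m - 1)).card := by simp
    _ ≤ _ := Finset.card_le_card hsub
    _ ≤ _ := Finset.card_biUnion_le_card_mul _ _ _ fun l _ =>
      Finset.card_image_le.trans (Finset.card_range m).le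

open Classical in
/-- The nonzero `2`-cyclotomic coset leaders modulo `n` that are at most `d`. -/
noncomputable def leadersUpTo (n d : ℕ) : Finset ℕ :=
  (Finset.range (d + 1)).filter fun a => a ≠ 0 ∧ IsCosetLeader 2 n a

theorem mem_leadersUpTo {n d a : ℕ} :
    a ∈ leadersUpTo n d ↔ a ≤ d ∧ a ≠ 0 ∧ IsCosetLeader 2 n a := by
  simp [leadersUpTo]

/-- Fermat's little theorem makes the truncated division in `h` exact, giving `2hm = n - 1`. -/
theorem mul_two_eq_of_prime (hm : m.Prime) (hm3 : 3 ≤ m) :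
    (2 ^ (m - 1) - 1) / m * m * 2 = 2 ^ m - 1 - 1 := by
  have hdvd : m ∣ 2 ^ (m - 1) - 1 := by
    have hc : Nat.Coprime 2 m := (Nat.coprime_of_lt_prime two_ne_zero (by omega) hm).symm
    have := Nat.ModEq.pow_totient hc
    rw [Nat.totient_prime hm] at this
    exact (Nat.modEq_iff_dvd' Nat.one_le_two_pow).1 this.symm
  rw [Nat.div_mul_cancel hdvd]
  obtain ⟨k, rfl⟩ : ∃ k, m = k + 1 := ⟨m - 1, by omega⟩
  have := Nat.one_le_two_pow (n := k)
  rw [Nat.add_sub_cancel, pow_succ]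
  omega

theorem div_pos_of_prime (hm : m.Prime) (hm3 : 3 ≤ m) : 0 < (2 ^ (m - 1) - 1) / m := by
  rw [Nat.pos_iff_ne_zero]
  intro h0
  have := mul_two_eq_of_prime hm hm3
  rw [h0] at this
  have : 2 ^ 3 ≤ 2 ^ m := Nat.pow_le_pow_right two_pos hm3
  omega

/-! ### The `h`-th nonzero coset leader. -/

section HalfLeader

variable (hm : m.Prime) (hm3 : 3 ≤ m) {h δ : ℕ} (hh : h = (2 ^ (m - 1) - 1) / m)
  (hδ : δ = nonzeroCosetLeader 2 (2 ^ m - 1) h)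

include hm hm3 hh

/-- There are at least `(n - 1) / m = 2h` nonzero leaders, so the `h`-th one exists and `Nat.nth`
does not fall back to its default value `0`. -/
theorem pred_lt_card_nonzero_cosetLeaders
    (hf : (Set.ofPred fun a => a ≠ 0 ∧ IsCosetLeader 2 (2 ^ m - 1) a).Finite) :
    h - 1 < hf.toFinset.card := by
  have h1 := le_card_nonzero_cosetLeaders_mul hm.ne_zero hf
  have h2 := mul_two_eq_of_prime hm hm3
  have h3 := div_pos_of_prime hm hm3
  rw [← hh] at h2 h3
  have h4 : h * 2 * m ≤ hf.toFinset.card * m := by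
    rw [mul_right_comm]
    omega
  have := Nat.le_of_mul_le_mul_right h4 hm.pos
  omega

include hδ

theorem nonzeroCosetLeader_spec : δ ≠ 0 ∧ IsCosetLeader 2 (2 ^ m - 1) δ := by
  rw [hδ]
  exact Nat.nth_mem (p := fun a => a ≠ 0 ∧ IsCosetLeader 2 (2 ^ m - 1) a) (h - 1)
    (pred_lt_card_nonzero_cosetLeaders hm hm3 hh)

theorem card_leadersUpTo : (leadersUpTo (2 ^ m - 1) δ).card = h := by
  classical
  have h1 := Nat.count_nth (p := fun a => a ≠ 0 ∧ IsCosetLeader 2 (2 ^ m - 1) a) (n := h - 1)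
    (pred_lt_card_nonzero_cosetLeaders hm hm3 hh)
  have h2 := nonzeroCosetLeader_spec hm hm3 hh hδ
  have h3 := Nat.count_succ (fun a => a ≠ 0 ∧ IsCosetLeader 2 (2 ^ m - 1) a) δ
  rw [if_pos h2] at h3
  change Nat.count _ (nonzeroCosetLeader 2 (2 ^ m - 1) h) = h - 1 at h1
  rw [← hδ] at h1
  rw [h1, Nat.count_eq_card_filter_range] at h3
  have h4 := div_pos_of_prime hm hm3
  rw [← hh] at h4
  have h5 : (leadersUpTo (2 ^ m - 1) δ).card = h - 1 + 1 := by
    rw [← h3, leadersUpTo]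
  omega

/-- The `h` nonzero leaders up to `δ` are distinct odd numbers, so `a ↦ a / 2` is injective on them.
-/
theorem two_mul_le_nonzeroCosetLeader_add_one : 2 * h ≤ δ + 1 := by
  have h1 : (leadersUpTo (2 ^ m - 1) δ).card ≤ (Finset.range ((δ + 1) / 2)).card := by
    apply Finset.card_le_card_of_injOn (fun a => a / 2)
    · intro a ha
      obtain ⟨had, ha0, hal⟩ := mem_leadersUpTo.1 (Finset.mem_coe.1 ha)
      have := Nat.odd_iff.1 (hal.odd hm.ne_zero ha0)
      simp only [Finset.coe_range, Set.mem_Iio]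
      omega
    · intro a ha b hb hab
      obtain ⟨-, ha0, hal⟩ := mem_leadersUpTo.1 (Finset.mem_coe.1 ha)
      obtain ⟨-, hb0, hbl⟩ := mem_leadersUpTo.1 (Finset.mem_coe.1 hb)
      have := Nat.odd_iff.1 (hal.odd hm.ne_zero ha0)
      have := Nat.odd_iff.1 (hbl.odd hm.ne_zero hb0)
      simp only at hab
      omega
  rw [card_leadersUpTo hm hm3 hh hδ, Finset.card_range] at h1
  omega

/-- The range reaches `δ + 1` because `δ` is odd: the leader of the coset of `i` is odd and at most
`δ + 1`, hence at most `δ`. -/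
theorem exists_mem_leadersUpTo {i : ℕ} (hi0 : i ≠ 0) (hi : i ≤ δ + 1) :
    ∃ l ∈ leadersUpTo (2 ^ m - 1) δ, l ∈ cyclotomicCoset 2 (2 ^ m - 1) i := by
  obtain ⟨hδ0, hδl⟩ := nonzeroCosetLeader_spec hm hm3 hh hδ
  have hodd := Nat.odd_iff.1 (hδl.odd hm.ne_zero hδ0)
  have hnodd := Nat.odd_iff.1 (odd_two_pow_sub_one hm.ne_zero)
  have hlt := hδl.lt
  -- Both `δ` and `n` are odd, so `δ < n` improves to `δ + 1 < n`.
  have hin : i < 2 ^ m - 1 := by omega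
  obtain ⟨l, hl, hlead, hle⟩ := exists_isCosetLeader_mem 2 hin
  have hl0 := ne_zero_of_mem_cyclotomicCoset hm.ne_zero hi0 hin hl
  have := Nat.odd_iff.1 (hlead.odd hm.ne_zero hl0)
  exact ⟨l, mem_leadersUpTo.2 ⟨by omega, hl0, hlead⟩, hl⟩

end HalfLeader

end Cosets
-- Words as polynomials; dimension and minimum distance of cyclic codes.
section WordPoly

variable {F : Type*} [Field F]

theorem wordPoly_apply {n : ℕ} (c : Fin n → F) :
    wordPoly n c = ∑ i : Fin n, monomial (i : ℕ) (c i) := by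
  simp [wordPoly]

theorem coeff_wordPoly {n : ℕ} (c : Fin n → F) (k : ℕ) :
    (wordPoly n c).coeff k = if h : k < n then c ⟨k, h⟩ else 0 := by
  rw [wordPoly_apply, finsetSum_coeff]
  simp only [coeff_monomial]
  split_ifs with h
  · rw [Finset.sum_eq_single ⟨k, h⟩]
    · simp
    · intro i _ hi
      rw [if_neg]
      rintro rfl
      exact hi rfl
    · simp
  · refine Finset.sum_eq_zero fun i _ => if_neg ?_
    rintro rfl
    exact h i.2

theorem coeff_wordPoly_fin {n : ℕ} (c : Fin n → F) (i : Fin n) :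
    (wordPoly n c).coeff i = c i := by
  rw [coeff_wordPoly, dif_pos i.2]

theorem wordPoly_injective (n : ℕ) : Function.Injective (wordPoly (F := F) n) := by
  intro c d h
  ext i
  rw [← coeff_wordPoly_fin c, h, coeff_wordPoly_fin]

theorem lt_of_mem_support_wordPoly {n : ℕ} {c : Fin n → F} {k : ℕ}
    (hk : k ∈ (wordPoly n c).support) : k < n := by
  by_contra h
  rw [mem_support_iff, coeff_wordPoly, dif_neg h] at hk
  exact hk rfl

theorem wordPoly_coeff {n : ℕ} {p : F[X]} (hp : ∀ k, n ≤ k → p.coeff k = 0) :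
    wordPoly n (fun i => p.coeff i) = p := by
  ext k
  rw [coeff_wordPoly]
  split_ifs with h
  · rfl
  · exact (hp k (not_lt.1 h)).symm

theorem card_support_wordPoly [DecidableEq F] {n : ℕ} (c : Fin n → F) :
    (wordPoly n c).support.card = hammingNorm c := by
  rw [hammingNorm, ← Finset.card_map Fin.valEmbedding]
  congr 1
  ext k
  simp only [mem_support_iff, coeff_wordPoly, Finset.mem_map, Finset.mem_filter, Finset.mem_univ,
    true_and, Fin.valEmbedding_apply]
  constructor
  · intro h
    by_cases hk : k < n
    · rw [dif_pos hk] at h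
      exact ⟨⟨k, hk⟩, h, rfl⟩
    · exact absurd (dif_neg hk) h
  · rintro ⟨i, hi, rfl⟩
    rwa [dif_pos i.2]

theorem mem_cyclicCode_iff {n : ℕ} {g : F[X]} (hg : g ∣ X ^ n - 1) {c : Fin n → F} :
    c ∈ cyclicCode n g ↔ g ∣ wordPoly n c := by
  have hpair : (Ideal.span {g, X ^ n - 1} : Ideal F[X]) = Ideal.span {g} := by
    rw [Ideal.span_insert, sup_eq_left, Ideal.span_singleton_le_span_singleton]
    exact hg
  change wordPoly n c ∈ (Ideal.span {g, X ^ n - 1} : Ideal F[X]) ↔ _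
  rw [hpair, Ideal.mem_span_singleton]

theorem isCyclicCode_cyclicCode (n : ℕ) (g : F[X]) : IsCyclicCode (cyclicCode n g) := by
  intro c hc
  cases n with
  | zero =>
    convert hc using 1
  | succ k =>
    -- The cyclic shift is multiplication by `X`, with the overflowing top term reduced by `X^n -
    -- 1`.
    have hshift : wordPoly (k + 1) (fun i => c ((finRotate (k + 1)).symm i)) =
        X * wordPoly (k + 1) c - C (c (Fin.last k)) * (X ^ (k + 1) - 1) := by
      have h0 : (finRotate (k + 1)).symm 0 = Fin.last k := by
        rw [Equiv.symm_apply_eq, finRotate_last]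
      have hs : ∀ i : Fin k, (finRotate (k + 1)).symm i.succ = i.castSucc := by
        intro i
        rw [Equiv.symm_apply_eq, finRotate_apply, Fin.coeSucc_eq_succ]
      rw [wordPoly_apply, wordPoly_apply, Fin.sum_univ_succ, Fin.sum_univ_castSucc, h0]
      simp only [hs, mul_add, Finset.mul_sum, X_mul_monomial, Fin.val_succ, Fin.val_castSucc,
        Fin.val_zero, Fin.val_last, monomial_zero_left, ← C_mul_X_pow_eq_monomial (n := k + 1)]
      ring
    change wordPoly _ _ ∈ (Ideal.span {g, X ^ (k + 1) - 1} : Ideal F[X])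
    have hc' : wordPoly (k + 1) c ∈ (Ideal.span {g, X ^ (k + 1) - 1} : Ideal F[X]) := hc
    rw [hshift]
    exact sub_mem (Ideal.mul_mem_left _ _ hc')
      (Ideal.mul_mem_left _ _ (Ideal.subset_span (Or.inr rfl)))

/-- The code is the kernel of the surjection from words to `F[X] / (g)`, whose dimension is `deg g`.
-/
theorem finrank_cyclicCode_add_natDegree {n : ℕ} (hn : n ≠ 0) {g : F[X]} (hg : g.Monic)
    (hdvd : g ∣ X ^ n - 1) :
    Module.finrank F (cyclicCode n g) + g.natDegree = n := by
  have hdeg : g.natDegree ≤ n := by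
    have h := natDegree_le_of_dvd hdvd
      (by simpa using (monic_X_pow_sub_C (1 : F) hn).ne_zero)
    rwa [← C_1, natDegree_X_pow_sub_C] at h
  let φ : (Fin n → F) →ₗ[F] (F[X] ⧸ Ideal.span {g}) :=
    (Ideal.Quotient.mkₐ F (Ideal.span {g})).toLinearMap ∘ₗ wordPoly n
  have hφ : ∀ c, φ c = Ideal.Quotient.mk (Ideal.span {g}) (wordPoly n c) := fun _ => rfl
  have hker : LinearMap.ker φ = cyclicCode n g := by
    ext c
    rw [LinearMap.mem_ker, hφ, Ideal.Quotient.eq_zero_iff_mem, Ideal.mem_span_singleton,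
      mem_cyclicCode_iff hdvd]
  have hsurj : LinearMap.range φ = ⊤ := by
    rw [LinearMap.range_eq_top]
    intro y
    obtain ⟨p, rfl⟩ := Ideal.Quotient.mk_surjective y
    refine ⟨fun i => (p %ₘ g).coeff i, ?_⟩
    rw [hφ, wordPoly_coeff, Ideal.Quotient.eq, Ideal.mem_span_singleton]
    · refine ⟨-(p /ₘ g), ?_⟩
      linear_combination modByMonic_add_div p g
    · intro k hk
      apply coeff_eq_zero_of_degree_lt
      refine (degree_modByMonic_lt p hg).trans_le (degree_le_natDegree.trans ?_)
      exact_mod_cast hdeg.trans hk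
  have h := LinearMap.finrank_range_add_finrank_ker φ
  rw [hsurj, finrank_top, hker, finrank_quotient_span_eq_natDegree, Module.finrank_fin_fun] at h
  omega

/-- By linearity distances are weights of differences. Nontriviality of `C` is needed because `sInf
∅ = 0`. -/
theorem le_minDist [DecidableEq F] {n d : ℕ} {C : Submodule F (Fin n → F)} (hC : C ≠ ⊥)
    (h : ∀ c ∈ C, c ≠ 0 → d ≤ hammingNorm c) : d ≤ minDist C := by
  obtain ⟨c, hc, hc0⟩ := Submodule.exists_mem_ne_zero_of_ne_bot hC
  have hne : {d | ∃ a ∈ C, ∃ b ∈ C, a ≠ b ∧ hammingDist a b = d}.Nonempty :=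
    ⟨_, c, hc, 0, C.zero_mem, hc0, rfl⟩
  obtain ⟨a, ha, b, hb, hab, hd⟩ := Nat.sInf_mem hne
  rw [minDist, ← hd, hammingDist_eq_hammingNorm]
  refine h _ (C.add_mem (C.neg_mem ha) hb) ?_
  rw [neg_add_eq_sub]
  exact sub_ne_zero.2 hab.symm

end WordPoly

/-! ### The BCH bound. -/

section BCHBound

variable {K : Type*} [Field K]

/-- If there were at most `k` nonzero coefficients, the vanishing conditions would contain a square
Vandermonde system with distinct nodes `β^j`, `j` in the support, which forces the coefficients to
be zero. The offset `b` only rescales the unknowns by `β^(b j)`. -/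
theorem lt_card_support_of_isRoot_zpow {β : K} {n : ℕ} (hβ : IsPrimitiveRoot β n) {p : K[X]}
    (hp : p ≠ 0) (hpn : ∀ k ∈ p.support, k < n) {b k : ℕ}
    (hroot : ∀ i < k, p.eval (β ^ (b + i)) = 0) : k < p.support.card := by
  by_contra! hle
  set e := p.support.equivFin.symm with he
  have hn : n ≠ 0 := by
    rintro rfl
    obtain ⟨j, hj⟩ := support_nonempty.2 hp
    exact absurd (hpn j hj) (Nat.not_lt_zero j)
  have hβ0 : β ≠ 0 := hβ.ne_zero hn
  have hzero : (fun j => p.coeff (e j) * β ^ (b * (e j : ℕ))) = 0 := by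
    refine Matrix.eq_zero_of_forall_pow_sum_mul_pow_eq_zero
      (f := fun j => β ^ (e j : ℕ)) ?_ ?_
    · intro i j hij
      exact e.injective (Subtype.ext (hβ.pow_inj (hpn _ (e i).2) (hpn _ (e j).2) hij))
    · intro i
      have h := hroot i (i.2.trans_le hle)
      rw [eval_eq_sum, Polynomial.sum, ← Finset.sum_coe_sort, ← e.sum_comp] at h
      rw [← h]
      refine Finset.sum_congr rfl fun j _ => ?_
      ring
  obtain ⟨j, hj⟩ := support_nonempty.2 hp
  have h := congr_fun hzero (e.symm ⟨j, hj⟩)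
  simp only [Equiv.apply_symm_apply, Pi.zero_apply, mul_eq_zero] at h
  rcases h with h | h
  · exact mem_support_iff.1 hj h
  · exact pow_ne_zero _ hβ0 h

end BCHBound

/-! ### Even and odd parts of a binary polynomial. -/

section Doubling

/-- Over `𝔽₂`, `f(x²) = f(x)²`, so the even and odd parts of `c` are a square and `X` times a
square. -/
theorem eq_contract_sq_add (c : (ZMod 2)[X]) :
    c = contract 2 c ^ 2 + X * contract 2 (divX c) ^ 2 := by
  rw [← ZMod.expand_card, ← ZMod.expand_card]
  ext k
  rw [coeff_add]
  rcases Nat.even_or_odd' k with ⟨j, rfl | rfl⟩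
  · rw [mul_comm 2 j, coeff_expand_mul two_pos, coeff_contract two_ne_zero]
    cases j with
    | zero => simp
    | succ j =>
      rw [show (j + 1) * 2 = (2 * j + 1) + 1 by ring, coeff_X_mul, coeff_expand two_pos,
        if_neg (by omega), add_zero]
  · rw [coeff_X_mul, mul_comm 2 j, coeff_expand_mul two_pos, coeff_contract two_ne_zero,
      coeff_expand two_pos, if_neg (by omega), coeff_divX, zero_add]

theorem card_support_contract_add (c : (ZMod 2)[X]) :
    (contract 2 c).support.card + (contract 2 (divX c)).support.card = c.support.card := by
  classical
  rw [← Finset.card_image_of_injective (contract 2 c).support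
      (mul_right_injective₀ (two_ne_zero (α := ℕ))),
    ← Finset.card_image_of_injective (contract 2 (divX c)).support
      ((add_left_injective 1).comp (mul_right_injective₀ (two_ne_zero (α := ℕ)))),
    ← Finset.card_union_of_disjoint]
  · congr 1
    ext k
    simp only [Finset.mem_union, Finset.mem_image, mem_support_iff, coeff_contract two_ne_zero,
      coeff_divX, Function.comp]
    constructor
    · rintro (⟨j, hj, rfl⟩ | ⟨j, hj, rfl⟩)
      · rwa [mul_comm]
      · rwa [mul_comm 2 j]
    · intro hk
      rcases Nat.even_or_odd' k with ⟨j, rfl | rfl⟩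
      · exact Or.inl ⟨j, by rwa [mul_comm], rfl⟩
      · exact Or.inr ⟨j, by rwa [mul_comm j 2], rfl⟩
  · rw [Finset.disjoint_left]
    simp only [Finset.mem_image, Function.comp]
    rintro k ⟨i, -, rfl⟩ ⟨j, -, hj⟩
    omega

/-- Differentiating `c = a² + X b²` in characteristic 2 leaves `b²`. Now `g² ∣ c` gives `g ∣ c' =
b²`, hence `g ∣ b` by squarefreeness, and then `g ∣ a² = c - X b²`. -/
theorem dvd_of_sq_dvd {g c : (ZMod 2)[X]} (hg : Squarefree g) (h : g ^ 2 ∣ c) :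
    g ∣ contract 2 c ∧ g ∣ contract 2 (divX c) := by
  have hder : derivative c = contract 2 (divX c) ^ 2 := by
    have h2 : (C (2 : ZMod 2)) = 0 := by
      rw [show (2 : ZMod 2) = 0 from rfl, C_0]
    conv_lhs => rw [eq_contract_sq_add c]
    simp [derivative_pow, h2]
  have hb : g ∣ contract 2 (divX c) := by
    obtain ⟨q, rfl⟩ := h
    refine (hg.dvd_pow_iff_dvd two_ne_zero).1 ?_
    rw [← hder, derivative_mul, pow_two]
    simp only [derivative_mul]
    exact ⟨derivative g * q + derivative g * q + g * derivative q, by ring⟩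
  refine ⟨(hg.dvd_pow_iff_dvd two_ne_zero).1 ?_, hb⟩
  have hc : contract 2 c ^ 2 = c - X * contract 2 (divX c) ^ 2 :=
    eq_sub_of_add_eq (eq_contract_sq_add c).symm
  rw [hc]
  exact dvd_sub ((dvd_pow_self g two_ne_zero).trans h)
    ((hb.trans (dvd_pow_self _ two_ne_zero)).mul_left X)

/-- A nonzero multiple of `g² (x - 1)` of degree `< 2n` has weight at least `min (2 d₁, d₂)`, where
`d₁` and `d₂` bound the weights of the nonzero multiples of `g` and of `g (x - 1)` of
degree `< n`. -/
theorem le_card_support_of_sq_mul_dvd {n d : ℕ} {g c : (ZMod 2)[X]} (hg : Squarefree g)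
    (hcop : IsCoprime g (X - 1))
    (h1 : ∀ p : (ZMod 2)[X], p ≠ 0 → (∀ k ∈ p.support, k < n) → g ∣ p → d ≤ 2 * p.support.card)
    (h2 : ∀ p : (ZMod 2)[X], p ≠ 0 → (∀ k ∈ p.support, k < n) → g * (X - 1) ∣ p →
      d ≤ p.support.card)
    (hc : c ≠ 0) (hcn : ∀ k ∈ c.support, k < 2 * n) (hdvd : g ^ 2 * (X - 1) ∣ c) :
    d ≤ c.support.card := by
  set a := contract 2 c with ha
  set b := contract 2 (divX c) with hb
  obtain ⟨hga, hgb⟩ := dvd_of_sq_dvd hg ((dvd_mul_right _ _).trans hdvd)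
  rw [← ha] at hga
  rw [← hb] at hgb
  have hcab : c = a ^ 2 + X * b ^ 2 := eq_contract_sq_add c
  have hcard : a.support.card + b.support.card = c.support.card := card_support_contract_add c
  have han : ∀ k ∈ a.support, k < n := by
    intro k hk
    rw [mem_support_iff, ha, coeff_contract two_ne_zero, ← mem_support_iff] at hk
    have := hcn _ hk
    omega
  have hbn : ∀ k ∈ b.support, k < n := by
    intro k hk
    rw [mem_support_iff, hb, coeff_contract two_ne_zero, coeff_divX, ← mem_support_iff] at hk
    have := hcn _ hk
    omega
  by_cases hab : a + b = 0
  · have hab' : a = b := by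
      rw [eq_neg_of_add_eq_zero_left hab, CharTwo.neg_eq]
    have hb0 : b ≠ 0 := by
      intro hb0
      rw [hab', hb0] at hcab
      exact hc (by simpa using hcab)
    rw [← hcard, hab', ← two_mul]
    exact h1 b hb0 hbn hgb
  · rw [← hcard]
    -- Here `a + b ≠ 0`, and `wt a + wt b ≥ wt (a + b)`.
    refine le_trans ?_ ((Finset.card_le_card support_add).trans (Finset.card_union_le _ _))
    refine h2 _ hab (fun k hk => ?_) ?_
    · rcases Finset.mem_union.1 (support_add hk) with h | h
      · exact han k h
      · exact hbn k h
    · refine hcop.mul_dvd (dvd_add hga hgb) ?_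
      -- At `1` the decomposition reads `c(1) = a(1)² + b(1)² = (a + b)(1)²`, so `X - 1` divides `a
      -- + b`.
      have h0 : c.eval 1 = 0 := by
        obtain ⟨q, rfl⟩ := hdvd
        simp
      rw [← C_1, dvd_iff_isRoot, IsRoot]
      rw [hcab, eval_add, eval_mul, eval_X, one_mul, eval_pow, eval_pow, ← CharTwo.add_sq,
        ← eval_add] at h0
      exact pow_eq_zero_iff two_ne_zero |>.1 h0

end Doubling
-- BCH generators up to units.
section BCHCode

variable {F : Type*} [Field F] {K : Type*} [Field K] [Algebra F K] {β : K}

theorem minpoly_dvd_bchPoly {δ : ℕ} {b : ℤ} {i : ℕ} (hi : i < δ - 1) :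
    minpoly F (β ^ (b + (i : ℤ))) ∣ bchPoly F β δ b := by
  classical
  let : NormalizedGCDMonoid F[X] := UniqueFactorizationMonoid.toNormalizedGCDMonoid F[X]
  exact Finset.dvd_lcm (f := fun i : ℕ => minpoly F (β ^ (b + (i : ℤ)))) (Finset.mem_range.2 hi)

theorem bchPoly_dvd {δ : ℕ} {b : ℤ} {q : F[X]}
    (h : ∀ i < δ - 1, minpoly F (β ^ (b + (i : ℤ))) ∣ q) : bchPoly F β δ b ∣ q := by
  classical
  let : NormalizedGCDMonoid F[X] := UniqueFactorizationMonoid.toNormalizedGCDMonoid F[X]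
  exact Finset.lcm_dvd fun i hi => h i (Finset.mem_range.1 hi)

theorem cyclicCode_eq_of_associated {n : ℕ} {g g' : F[X]} (h : Associated g g') :
    cyclicCode n g = cyclicCode n g' := by
  rw [cyclicCode, cyclicCode, Ideal.span_insert, Ideal.span_insert,
    Ideal.span_singleton_eq_span_singleton.2 h]

end BCHCode

/-! ### The two BCH codes and their doubled code. -/

section HalfBCH

variable {K : Type*} [Field K] [Algebra (ZMod 2) K] {β : K} {m : ℕ}

theorem isIntegral_pow_of_isPrimitiveRoot {n : ℕ} (hn : n ≠ 0) (hβ : IsPrimitiveRoot β n) (a : ℕ) :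
    IsIntegral (ZMod 2) (β ^ a) := by
  refine IsIntegral.pow ⟨X ^ n - 1, ?_, ?_⟩ a
  · simpa using monic_X_pow_sub_C (1 : ZMod 2) hn
  · simp [hβ.pow_eq_one]

theorem minpoly_pow_dvd_X_pow_sub_one {n : ℕ} (hβ : IsPrimitiveRoot β n) (a : ℕ) :
    minpoly (ZMod 2) (β ^ a) ∣ X ^ n - 1 := by
  apply minpoly.dvd
  simp [← pow_mul, mul_comm a n, pow_mul β n, hβ.pow_eq_one]

theorem minpoly_pow_eq_of_mem {n : ℕ} (hn : n ≠ 0) (hβ : IsPrimitiveRoot β n) {a l : ℕ}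
    (hl : l ∈ cyclotomicCoset 2 n a) :
    minpoly (ZMod 2) (β ^ l) = minpoly (ZMod 2) (β ^ a) := by
  refine (minpoly.eq_of_irreducible_of_monic
    (minpoly.irreducible (isIntegral_pow_of_isPrimitiveRoot hn hβ a)) ?_
    (minpoly.monic (isIntegral_pow_of_isPrimitiveRoot hn hβ a))).symm
  have hfin : (cyclotomicCoset 2 n a).Finite := (Set.finite_lt_nat n).subset fun _ hu =>
    lt_of_mem_cyclotomicCoset (Nat.pos_of_ne_zero hn) hu
  have h := map_minpoly_eq_prod (F := ZMod 2) hn hβ a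
  rw [ZMod.card, finprod_mem_eq_finite_toFinset_prod _ hfin] at h
  rw [aeval_def, ← eval_map, h, eval_prod]
  exact Finset.prod_eq_zero (hfin.mem_toFinset.2 hl) (by simp)

/-- The roots of the minimal polynomial of `β^a` are the powers `β^j` with `j` in the coset of `a`,
and exponents below `n` are determined by the power. -/
theorem mem_cyclotomicCoset_of_minpoly_eq {n : ℕ} (hn : n ≠ 0) (hβ : IsPrimitiveRoot β n)
    {a b : ℕ} (hb : b < n) (hab : minpoly (ZMod 2) (β ^ a) = minpoly (ZMod 2) (β ^ b)) :
    b ∈ cyclotomicCoset 2 n a := by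
  have hfin : (cyclotomicCoset 2 n a).Finite := (Set.finite_lt_nat n).subset fun _ hu =>
    lt_of_mem_cyclotomicCoset (Nat.pos_of_ne_zero hn) hu
  have h := map_minpoly_eq_prod (F := ZMod 2) hn hβ a
  rw [ZMod.card, finprod_mem_eq_finite_toFinset_prod _ hfin] at h
  have h0 := minpoly.aeval (ZMod 2) (β ^ b)
  rw [← hab, aeval_def, ← eval_map, h, eval_prod, Finset.prod_eq_zero_iff] at h0
  obtain ⟨j, hj, hj0⟩ := h0
  rw [hfin.mem_toFinset] at hj
  rw [eval_sub, eval_X, eval_C, sub_eq_zero] at hj0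
  rwa [hβ.pow_inj hb (lt_of_mem_cyclotomicCoset (Nat.pos_of_ne_zero hn) hj) hj0]

theorem natDegree_minpoly_pow (hm : m.Prime) (hβ : IsPrimitiveRoot β (2 ^ m - 1)) {a : ℕ}
    (ha : ¬ 2 ^ m - 1 ∣ a) : (minpoly (ZMod 2) (β ^ a)).natDegree = m := by
  have hn : 2 ^ m - 1 ≠ 0 := (odd_two_pow_sub_one hm.ne_zero).pos.ne'
  have h := map_minpoly_eq_prod (F := ZMod 2) hn hβ a
  rw [ZMod.card, cyclotomicCoset_eq_image_range hm.ne_zero, finprod_mem_coe_finset] at h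
  rw [← natDegree_map (algebraMap (ZMod 2) K), h, natDegree_prod_of_monic _ _ fun j _ =>
    monic_X_sub_C _]
  simp only [natDegree_X_sub_C, Finset.sum_const, smul_eq_mul, mul_one]
  rw [Finset.card_image_of_injOn (injOn_mul_two_pow_mod hm ha), Finset.card_range]

theorem isCoprime_minpoly_pow (hm : m ≠ 0) (hβ : IsPrimitiveRoot β (2 ^ m - 1)) {a b : ℕ}
    (ha : IsCosetLeader 2 (2 ^ m - 1) a) (hb : IsCosetLeader 2 (2 ^ m - 1) b) (hab : a ≠ b) :
    IsCoprime (minpoly (ZMod 2) (β ^ a)) (minpoly (ZMod 2) (β ^ b)) := by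
  have hn : 2 ^ m - 1 ≠ 0 := (odd_two_pow_sub_one hm).pos.ne'
  have hia := isIntegral_pow_of_isPrimitiveRoot hn hβ a
  have hib := isIntegral_pow_of_isPrimitiveRoot hn hβ b
  rw [(minpoly.irreducible hia).coprime_iff_not_dvd]
  intro hdvd
  have heq := eq_of_monic_of_associated (minpoly.monic hia) (minpoly.monic hib)
    ((minpoly.irreducible hia).associated_of_dvd (minpoly.irreducible hib) hdvd)
  have hmem := mem_cyclotomicCoset_of_minpoly_eq hn hβ hb.lt heq
  have hla := ha.isLeast hm
  rw [← cyclotomicCoset_eq_of_mem hm hmem] at hla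
  exact hab (hla.unique (hb.isLeast hm))

variable (β) in
/-- The product of the minimal polynomials of `β^a` over the nonzero coset leaders `a ≤ d`. -/
noncomputable def leaderProd (n d : ℕ) : (ZMod 2)[X] :=
  ∏ a ∈ leadersUpTo n d, minpoly (ZMod 2) (β ^ a)

theorem leaderProd_monic {n : ℕ} (hn : n ≠ 0) (hβ : IsPrimitiveRoot β n) (d : ℕ) :
    (leaderProd β n d).Monic :=
  monic_prod_of_monic _ _ fun a _ => minpoly.monic (isIntegral_pow_of_isPrimitiveRoot hn hβ a)

theorem leaderProd_dvd (hm : m ≠ 0) (hβ : IsPrimitiveRoot β (2 ^ m - 1)) {d : ℕ} {q : (ZMod 2)[X]}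
    (h : ∀ a ∈ leadersUpTo (2 ^ m - 1) d, minpoly (ZMod 2) (β ^ a) ∣ q) :
    leaderProd β (2 ^ m - 1) d ∣ q :=
  Finset.prod_dvd_of_coprime (fun _ ha _ hb hab => isCoprime_minpoly_pow hm hβ
    (mem_leadersUpTo.1 ha).2.2 (mem_leadersUpTo.1 hb).2.2 hab) h

theorem minpoly_pow_zero : minpoly (ZMod 2) (β ^ 0) = X - 1 := by
  rw [pow_zero, minpoly.one]

theorem isCosetLeader_zero {q n : ℕ} (hn : 0 < n) : IsCosetLeader q n 0 :=
  ⟨0, hn, ⟨0, by simp⟩, fun _ _ => Nat.zero_le _⟩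

theorem isCoprime_leaderProd_X_sub_one (hm : m ≠ 0) (hβ : IsPrimitiveRoot β (2 ^ m - 1)) (d : ℕ) :
    IsCoprime (leaderProd β (2 ^ m - 1) d) (X - 1) := by
  refine IsCoprime.prod_left fun a ha => ?_
  rw [← minpoly_pow_zero (β := β)]
  obtain ⟨-, ha0, hal⟩ := mem_leadersUpTo.1 ha
  exact isCoprime_minpoly_pow hm hβ hal (isCosetLeader_zero (odd_two_pow_sub_one hm).pos) ha0

theorem leaderProd_mul_dvd (hm : m ≠ 0) (hβ : IsPrimitiveRoot β (2 ^ m - 1)) (d : ℕ) :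
    leaderProd β (2 ^ m - 1) d * (X - 1) ∣ X ^ (2 ^ m - 1) - 1 :=
  (isCoprime_leaderProd_X_sub_one hm hβ d).mul_dvd
    (leaderProd_dvd hm hβ fun a _ => minpoly_pow_dvd_X_pow_sub_one hβ a)
    (sub_one_dvd_pow_sub_one _ _)

/-- It divides `X^n - 1`, which is separable over `𝔽₂` because `n` is odd. -/
theorem squarefree_leaderProd (hm : m ≠ 0) (hβ : IsPrimitiveRoot β (2 ^ m - 1)) (d : ℕ) :
    Squarefree (leaderProd β (2 ^ m - 1) d) := by
  refine Squarefree.squarefree_of_dvd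
    ((dvd_mul_right _ _).trans (leaderProd_mul_dvd hm hβ d)) (Separable.squarefree ?_)
  rw [X_pow_sub_one_separable_iff, Ne, ZMod.natCast_eq_zero_iff_even, Nat.not_even_iff_odd]
  exact odd_two_pow_sub_one hm

theorem eval_pow_eq_zero_of_minpoly_dvd {g p : (ZMod 2)[X]} {a : ℕ}
    (h : minpoly (ZMod 2) (β ^ a) ∣ g) (hp : g ∣ p) :
    (p.map (algebraMap (ZMod 2) K)).eval (β ^ a) = 0 := by
  rw [eval_map_algebraMap]
  exact aeval_eq_zero_of_dvd_aeval_eq_zero (h.trans hp) (minpoly.aeval _ _)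

section

variable (hm : m.Prime) (hm3 : 3 ≤ m) {h δ : ℕ} (hh : h = (2 ^ (m - 1) - 1) / m)
  (hδ : δ = nonzeroCosetLeader 2 (2 ^ m - 1) h) (hβ : IsPrimitiveRoot β (2 ^ m - 1))

include hm hm3 hh hδ hβ

theorem natDegree_leaderProd : (leaderProd β (2 ^ m - 1) δ).natDegree = h * m := by
  have hn : 2 ^ m - 1 ≠ 0 := (odd_two_pow_sub_one hm.ne_zero).pos.ne'
  rw [leaderProd, natDegree_prod_of_monic _ _ fun a _ =>
    minpoly.monic (isIntegral_pow_of_isPrimitiveRoot hn hβ a)]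
  rw [Finset.sum_const_nat (m := m), card_leadersUpTo hm hm3 hh hδ]
  intro a ha
  obtain ⟨-, ha0, hal⟩ := mem_leadersUpTo.1 ha
  refine natDegree_minpoly_pow hm hβ fun hdvd => ?_
  exact absurd (Nat.le_of_dvd (Nat.pos_of_ne_zero ha0) hdvd) (not_le.2 hal.lt)

/-- Conjugate powers share a minimal polynomial, so that of `β^i` is already the factor of its
leader; this supplies the consecutive zeros for the BCH bound. -/
theorem minpoly_dvd_leaderProd {i : ℕ} (hi0 : i ≠ 0) (hi : i ≤ δ + 1) :
    minpoly (ZMod 2) (β ^ i) ∣ leaderProd β (2 ^ m - 1) δ := by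
  have hn : 2 ^ m - 1 ≠ 0 := (odd_two_pow_sub_one hm.ne_zero).pos.ne'
  obtain ⟨l, hl, hli⟩ := exists_mem_leadersUpTo hm hm3 hh hδ hi0 hi
  rw [← minpoly_pow_eq_of_mem hn hβ hli]
  exact Finset.dvd_prod_of_mem _ hl

theorem bchCode_one_eq :
    bchCode (ZMod 2) β (2 ^ m - 1) (δ + 2) 1 =
      cyclicCode (2 ^ m - 1) (leaderProd β (2 ^ m - 1) δ) := by
  refine cyclicCode_eq_of_associated (associated_of_dvd_dvd (bchPoly_dvd fun i hi => ?_)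
    (leaderProd_dvd hm.ne_zero hβ fun a ha => ?_))
  · have := minpoly_dvd_leaderProd hm hm3 hh hδ hβ (i := 1 + i) (by omega) (by omega)
    rwa [← zpow_natCast, Nat.cast_add, Nat.cast_one] at this
  · obtain ⟨hle, ha0, -⟩ := mem_leadersUpTo.1 ha
    have := minpoly_dvd_bchPoly (F := ZMod 2) (β := β) (δ := δ + 2) (b := 1) (i := a - 1) (by omega)
    rwa [← Nat.cast_one, ← Nat.cast_add, zpow_natCast, Nat.add_sub_cancel' (by omega)] at this

theorem bchCode_zero_eq :
    bchCode (ZMod 2) β (2 ^ m - 1) (δ + 2) 0 =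
      cyclicCode (2 ^ m - 1) (leaderProd β (2 ^ m - 1) δ * (X - 1)) := by
  refine cyclicCode_eq_of_associated (associated_of_dvd_dvd (bchPoly_dvd fun i hi => ?_)
    ((isCoprime_leaderProd_X_sub_one hm.ne_zero hβ δ).mul_dvd
      (leaderProd_dvd hm.ne_zero hβ fun a ha => ?_) ?_))
  · rw [zero_add, zpow_natCast]
    rcases eq_or_ne i 0 with rfl | hi0
    · rw [minpoly_pow_zero]
      exact dvd_mul_left _ _
    · exact (minpoly_dvd_leaderProd hm hm3 hh hδ hβ hi0 (by omega)).trans (dvd_mul_right _ _)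
  · obtain ⟨hle, -, -⟩ := mem_leadersUpTo.1 ha
    have := minpoly_dvd_bchPoly (F := ZMod 2) (β := β) (δ := δ + 2) (b := 0) (i := a) (by omega)
    rwa [zero_add, zpow_natCast] at this
  · have := minpoly_dvd_bchPoly (F := ZMod 2) (β := β) (δ := δ + 2) (b := 0) (i := 0) (by omega)
    rwa [zero_add, zpow_natCast, minpoly_pow_zero] at this

theorem doubledCode_bchCode_eq :
    doubledCode (bchCode (ZMod 2) β (2 ^ m - 1) (δ + 2) 1)
      (bchCode (ZMod 2) β (2 ^ m - 1) (δ + 2) 0) =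
      cyclicCode (2 * (2 ^ m - 1)) (leaderProd β (2 ^ m - 1) δ ^ 2 * (X - 1)) := by
  have hn : 2 ^ m - 1 ≠ 0 := (odd_two_pow_sub_one hm.ne_zero).pos.ne'
  have hmon := leaderProd_monic hn hβ δ
  have hdvd := leaderProd_mul_dvd hm.ne_zero hβ δ
  have hmon1 : (X - 1 : (ZMod 2)[X]).Monic := by simpa using monic_X_sub_C (1 : ZMod 2)
  rw [doubledCode, bchCode_one_eq hm hm3 hh hδ hβ, bchCode_zero_eq hm hm3 hh hδ hβ,
    generatorPoly_cyclicCode hn hmon ((dvd_mul_right _ _).trans hdvd),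
    generatorPoly_cyclicCode hn (hmon.mul hmon1) hdvd, mul_div_cancel_left₀ _ hmon.ne_zero]

theorem lt_card_support_of_leaderProd_dvd {p : (ZMod 2)[X]} (hp : p ≠ 0)
    (hpn : ∀ k ∈ p.support, k < 2 ^ m - 1) (hdvd : leaderProd β (2 ^ m - 1) δ ∣ p) :
    δ + 1 < p.support.card := by
  have hinj := (algebraMap (ZMod 2) K).injective
  rw [← support_map_of_injective p hinj] at hpn ⊢
  exact lt_card_support_of_isRoot_zpow hβ ((Polynomial.map_ne_zero_iff hinj).2 hp) hpn (b := 1)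
    fun i hi => eval_pow_eq_zero_of_minpoly_dvd
      (minpoly_dvd_leaderProd hm hm3 hh hδ hβ (by omega) (by omega)) hdvd

theorem lt_card_support_of_leaderProd_mul_dvd {p : (ZMod 2)[X]} (hp : p ≠ 0)
    (hpn : ∀ k ∈ p.support, k < 2 ^ m - 1)
    (hdvd : leaderProd β (2 ^ m - 1) δ * (X - 1) ∣ p) :
    δ + 2 < p.support.card := by
  have hinj := (algebraMap (ZMod 2) K).injective
  rw [← support_map_of_injective p hinj] at hpn ⊢
  refine lt_card_support_of_isRoot_zpow hβ ((Polynomial.map_ne_zero_iff hinj).2 hp) hpn (b := 0)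
    fun i hi => ?_
  rw [zero_add]
  rcases eq_or_ne i 0 with rfl | hi0
  · refine eval_pow_eq_zero_of_minpoly_dvd (g := X - 1) ?_ ((dvd_mul_left _ _).trans hdvd)
    rw [minpoly_pow_zero]
  · exact eval_pow_eq_zero_of_minpoly_dvd
      (minpoly_dvd_leaderProd hm hm3 hh hδ hβ hi0 (by omega)) ((dvd_mul_right _ _).trans hdvd)

end

end HalfBCH

/-! ### Repeated roots and the main theorem. -/

theorem X_pow_two_mul_sub_one (n : ℕ) :
    (X ^ (2 * n) - 1 : (ZMod 2)[X]) = (X ^ n - 1) ^ 2 := by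
  rw [CharTwo.sub_eq_add, CharTwo.sub_eq_add, CharTwo.add_sq, one_pow, mul_comm, pow_mul]

theorem exists_two_le_rootMultiplicity {F : Type*} [Field F] {g p : F[X]} (hg : g.natDegree ≠ 0)
    (hp : p ≠ 0) (h : g ^ 2 ∣ p) :
    ∃ a : AlgebraicClosure F, 2 ≤ (p.map (algebraMap F (AlgebraicClosure F))).rootMultiplicity a := by
  have hinj := (algebraMap F (AlgebraicClosure F)).injective
  obtain ⟨a, ha⟩ := IsAlgClosed.exists_root (g.map (algebraMap F (AlgebraicClosure F))) (by
    rw [degree_map]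
    exact fun h0 => hg (natDegree_eq_zero_iff_degree_le_zero.2 h0.le))
  refine ⟨a, (le_rootMultiplicity_iff ((Polynomial.map_ne_zero_iff hinj).2 hp)).2 ?_⟩
  refine (pow_dvd_pow_of_dvd (dvd_iff_isRoot.2 ha) 2).trans ?_
  rw [← Polynomial.map_pow]
  exact Polynomial.map_dvd _ h

end CyclicCodes

theorem mainTheorem4 (m : ℕ) (hm : m.Prime) (hm3 : 3 ≤ m) (n h δ : ℕ) (hn : n = 2 ^ m - 1)
    (hh : h = (2 ^ (m - 1) - 1) / m) (hδ : δ = CyclicCodes.nonzeroCosetLeader 2 n h)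
    {K : Type*} [Field K] [Algebra (ZMod 2) K] (β : K) (hβ : IsPrimitiveRoot β n)
    (C : Submodule (ZMod 2) (Fin (2 * n) → ZMod 2))
    (hC : C = CyclicCodes.doubledCode (CyclicCodes.bchCode (ZMod 2) β n (δ + 2) 1)
      (CyclicCodes.bchCode (ZMod 2) β n (δ + 2) 0)) :
    CyclicCodes.IsRepeatedRootCyclicCode C ∧
      Module.finrank (ZMod 2) C = n ∧
      δ + 3 ≤ CyclicCodes.minDist C ∧
      ((n : ℝ) - 1 + 2 * (m : ℝ)) / (m : ℝ) ≤ (δ : ℝ) + 3 := by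
  open CyclicCodes in
  subst hn
  rw [doubledCode_bchCode_eq hm hm3 hh hδ hβ] at hC
  have hn0 : 2 ^ m - 1 ≠ 0 := (odd_two_pow_sub_one hm.ne_zero).pos.ne'
  have h2n0 : 2 * (2 ^ m - 1) ≠ 0 := mul_ne_zero two_ne_zero hn0
  have hmon := leaderProd_monic hn0 hβ δ
  have hdeg := natDegree_leaderProd hm hm3 hh hδ hβ
  have hcount : h * m * 2 = 2 ^ m - 1 - 1 := by
    rw [hh]
    exact mul_two_eq_of_prime hm hm3
  have hh0 : 0 < h := by
    rw [hh]
    exact div_pos_of_prime hm hm3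
  have hmon1 : (X - 1 : (ZMod 2)[X]).Monic := by simpa using monic_X_sub_C (1 : ZMod 2)
  have hdeg1 : (X - 1 : (ZMod 2)[X]).natDegree = 1 := by
    simpa using natDegree_X_sub_C (1 : ZMod 2)
  have hGmon : (leaderProd β (2 ^ m - 1) δ ^ 2 * (X - 1)).Monic := (hmon.pow 2).mul hmon1
  have hGdvd : leaderProd β (2 ^ m - 1) δ ^ 2 * (X - 1) ∣ X ^ (2 * (2 ^ m - 1)) - 1 := by
    rw [X_pow_two_mul_sub_one]
    refine dvd_trans ?_ (pow_dvd_pow_of_dvd (leaderProd_mul_dvd hm.ne_zero hβ δ) 2)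
    rw [mul_pow]
    exact mul_dvd_mul_left _ (dvd_pow_self _ two_ne_zero)
  have hrank : Module.finrank (ZMod 2) C = 2 ^ m - 1 := by
    have h1 := finrank_cyclicCode_add_natDegree h2n0 hGmon hGdvd
    rw [← hC, (hmon.pow 2).natDegree_mul hmon1, hmon.natDegree_pow, hdeg, hdeg1] at h1
    -- The generator has degree `2hm + 1 = n`, leaving dimension `2n - n`.
    omega
  refine ⟨⟨?_, ?_⟩, hrank, ?_, ?_⟩
  · rw [hC]
    exact isCyclicCode_cyclicCode _ _
  · rw [hC, generatorPoly_cyclicCode h2n0 hGmon hGdvd]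
    refine exists_two_le_rootMultiplicity ?_ hGmon.ne_zero (dvd_mul_right _ _)
    rw [hdeg]
    exact (Nat.mul_pos hh0 hm.pos).ne'
  · apply le_minDist
    · rintro rfl
      rw [finrank_bot] at hrank
      exact hn0 hrank.symm
    · intro c hc hc0
      rw [hC, mem_cyclicCode_iff hGdvd] at hc
      rw [← card_support_wordPoly]
      refine le_card_support_of_sq_mul_dvd (squarefree_leaderProd hm.ne_zero hβ δ)
        (isCoprime_leaderProd_X_sub_one hm.ne_zero hβ δ) (fun p hp hpn hdvd => ?_)
        (fun p hp hpn hdvd => lt_card_support_of_leaderProd_mul_dvd hm hm3 hh hδ hβ hp hpn hdvd)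
        ((map_ne_zero_iff _ (wordPoly_injective _)).2 hc0)
        (fun k hk => lt_of_mem_support_wordPoly hk) hc
      have := lt_card_support_of_leaderProd_dvd hm hm3 hh hδ hβ hp hpn hdvd
      -- Twice the weight of a multiple of `g` is at least `2 (δ + 2) ≥ δ + 3`.
      omega
  · have hle := two_mul_le_nonzeroCosetLeader_add_one hm hm3 hh hδ
    have hpos : (0 : ℝ) < m := by exact_mod_cast hm.pos
    have hle' : (2 : ℝ) * h ≤ δ + 1 := by exact_mod_cast hle
    have hn' : ((2 ^ m - 1 : ℕ) : ℝ) = h * m * 2 + 1 := by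
      rw [show 2 ^ m - 1 = h * m * 2 + 1 by omega]
      push_cast
      ring
    rw [hn', div_le_iff₀ hpos]
    -- After clearing `m`, the claim is `2hm + 2m ≤ (δ + 3) m`, which is `2h ≤ δ + 1` times `m`.
    nlinarith
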